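/- Let $n,m,k\ge 1$ be integers. A deterministic coverage oracle for $(n,m,k)$ has two stages. The static stage maps every set system $\mathcal I=(S_1,\dots,S_m)$ of $m$ (not necessarily distinct) subsets of $\mathcal X=\{1,\dots,n\}$ to a data structure, which is a finite string of bits. The dynamic stage maps this string together with a query $Q\subseteq\mathcal X$ to a set $J\subseteq\{1,\dots,m\}$ of at most $k$ indices. Both stages are arbitrary functions, with no bound on their computation time. The approximation ratio $\alpha$ of the oracle is the maximum, over all set systems $\mathcal I$ and queries $Q$, of $$\frac{\max\{|\bigcup_{i\in J^*}S_i\cap Q| : J^*\subseteq\{1,\dots,m\},\ |J^*|\le k\}}{|\bigcup_{i\in J}S_i\cap Q|},$$ where $J$ is the answer of the oracle (the quotient is $\infty$ if only its denominator is $0$; pairs with both equal to $0$ are disregarded). Theorem. For all constants $\delta>0$ and $C>0$ there is an $N$, depending only on $\delta$ and $C$, such that the following holds for all integers $n,m\ge N$ and $k\ge 1$, all real $b$ with $n\le b\le nm$, the real $\epsilon$ with $b=n\,m^{1-2\epsilon}$, and every deterministic coverage oracle for $(n,m,k)$ whose data structure always has at most $b$ bits. (1) If $m^{\epsilon}\le\sqrt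 n$, then $\alpha> C\cdot\dfrac{m^{\epsilon-\delta}}{k\sqrt k}$. (2) If $\sqrt n\le m^{\epsilon}$ and $b\le e^{n^{\delta}}$ (for example, if $m$ is at most polynomial in $n$), then $\alpha> C\cdot\dfrac{n^{1/2-\delta}}{k\sqrt k}$. In particular, a deterministic oracle with $b=b(n,m,k)$ bits does not attain an approximation ratio of $O(m^{\epsilon-\delta}/(k\sqrt k))$ where $m^{\epsilon}\le\sqrt n$, nor of $O(n^{1/2-\delta}/(k\sqrt k))$ where $\sqrt n\le m^{\epsilon}$ and $b\le e^{n^\delta}$, for any constant $\delta>0$, as $n,m\to\infty$. -/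

import Mathlib

open scoped ENNReal

/-- The number of elements of the query `Q` covered by the members of the set system
`I = (I 0, …, I (m-1))` on the ground set `Fin n` whose indices lie in `J`. -/
def coverage {n m : ℕ} (I : Fin m → Finset (Fin n)) (J : Finset (Fin m))
    (Q : Finset (Fin n)) : ℕ :=
  (J.biUnion I ∩ Q).card

/-- The largest number of elements of `Q` that at most `k` members of `I` cover together. -/
def optCoverage {n m : ℕ} (k : ℕ) (I : Fin m → Finset (Fin n)) (Q : Finset (Fin n)) : ℕ :=
  ((Finset.univ : Finset (Finset (Fin m))).filter (fun J => J.card ≤ k)).sup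
    (fun J => coverage I J Q)

/-- A deterministic coverage oracle for set systems with `n` elements and `m` sets and for
solutions of at most `k` sets. The static stage turns the set system into a data structure, an
arbitrary string of bits; the dynamic stage sees only this string and the query, and returns
the indices of at most `k` sets. Both stages are arbitrary functions. -/
structure CoverageOracle (n m k : ℕ) where
  /-- the static stage -/
  store : (Fin m → Finset (Fin n)) → List Bool
  /-- the dynamic stage -/
  answer : List Bool → Finset (Fin n) → Finset (Fin m)
  card_answer_le : ∀ (I : Fin m → Finset (Fin n)) (Q : Finset (Fin n)),
    (answer (store I) Q).card ≤ k

namespace CoverageOracle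

/-- The data structure of the oracle never has more than `b` bits. -/
def UsesAtMost {n m k : ℕ} (A : CoverageOracle n m k) (b : ℝ) : Prop :=
  ∀ I : Fin m → Finset (Fin n), ((A.store I).length : ℝ) ≤ b

/-- The coverage achieved by the oracle on the set system `I` and the query `Q`. -/
def value {n m k : ℕ} (A : CoverageOracle n m k) (I : Fin m → Finset (Fin n))
    (Q : Finset (Fin n)) : ℕ :=
  coverage I (A.answer (A.store I) Q) Q

/-- The approximation ratio: the worst case, over all set systems and all queries, of the
optimal coverage divided by the coverage achieved by the oracle. In `ℝ≥0∞` the quotient is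
`∞` if only the denominator vanishes, and `0 / 0 = 0`, so queries that no set meets do not
count. -/
noncomputable def approxRatio {n m k : ℕ} (A : CoverageOracle n m k) : ℝ≥0∞ :=
  ⨆ (I : Fin m → Finset (Fin n)) (Q : Finset (Fin n)),
    (optCoverage k I Q : ℝ≥0∞) / (A.value I Q : ℝ≥0∞)

end CoverageOracle

/-!
A short data structure cannot determine a large family of set systems, and an oracle with a good
approximation ratio would have to.

Let `p` be a prime and split (most of) the ground set into `L` blocks, each a copy of the plane
`ZMod p × ZMod p`. In a block, draw graphs of polynomials of degree at most `l` over `ZMod p`,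
where `l` is the logarithm of `2 * M` to base `p`, so that there are more than `2 * M`
polynomials. A graph has `p` points, and two different graphs share at most `l` points. Choose, in
every block independently, an injection from `M` indices to the polynomials; the `i`-th set is the
union over the blocks of the graphs chosen for `i` (`blockSystem`). For the query that is the
graph of index `i` in one block, the `i`-th set alone covers `p` elements, while `k` other sets
cover at most `k * l` (`coverage_blockSystem_le`). So an oracle of ratio below `p / (k * l)` has
to return the index `i` among its at most `k` answers.

Fix the stored string. In every block the answers attach at most `k` labels to each polynomial, and
a family stored as this string sends each index `i` to a polynomial with the label `i`. By the
inequality of the arithmetic and geometric means only a fraction `(k / M) ^ (M * L)` of all maps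
do so (`card_consistent_mul_le`), whereas at least a fraction `2 ^ (-M * L)` are families of
injections. Hence fewer than about `M * L * log (M / (2 * k))` bits do not suffice
(`exists_bad_query`).

It remains to choose `p`, `L` and `M` (`ofReal_lt_approxRatio_of_parameters`). If `m ^ ε ≤ √n`, take
`p` about `m ^ ε` and `M = m`: then `M * L` is about `n * m / m ^ (2 * ε) = b`, and `l` is at most
logarithmic in `m`. If `√n ≤ m ^ ε`, then `b ≤ m`; take `p` about `√n` and `M` about `b`.
In both cases `M / k` may be assumed large, as the ratio of an oracle is never below `1`. This
gives the stronger lower bound `p / (k * l)`, with `k` in place of `k * √k`.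
-/

/-! ### Sets from Reed–Solomon words -/

section ReedSolomon

variable {K : Type*} [Field K] [Fintype K] {n m M L d : ℕ}

/-- The value at `x` of the polynomial with coefficient vector `w`. -/
def wordEval (w : Fin d → K) (x : K) : K := ∑ j, w j * x ^ (j : ℕ)

/-- The graph of the polynomial with coefficient vector `w`, drawn in the block `β` of the
ground set; the embedding `e` places `L` disjoint copies of `K × K` in `Fin n`. -/
def wordGraph (e : Fin L × K × K ↪ Fin n) (β : Fin L) (w : Fin d → K) : Finset (Fin n) :=
  Finset.univ.image fun x => e (β, x, wordEval w x)

/-- The set system whose `i`-th set, for `i < M`, is the union over all blocks `β` of the graph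
of the word `c β i`. The remaining sets are empty. -/
def blockSystem (m : ℕ) (e : Fin L × K × K ↪ Fin n) (c : Fin L → Fin M ↪ (Fin d → K)) :
    Fin m → Finset (Fin n) :=
  fun i => if h : (i : ℕ) < M then Finset.univ.biUnion fun β => wordGraph e β (c β ⟨i, h⟩) else ∅

variable (e : Fin L × K × K ↪ Fin n)

lemma card_wordGraph (β : Fin L) (w : Fin d → K) :
    (wordGraph e β w).card = Fintype.card K := by
  rw [wordGraph, Finset.card_image_of_injective, Finset.card_univ]
  intro x y h
  exact (Prod.mk.inj (Prod.mk.inj (e.injective h)).2).1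

lemma wordGraph_subset_blockSystem (hM : M ≤ m) (c : Fin L → Fin M ↪ (Fin d → K)) (β : Fin L)
    (i : Fin M) : wordGraph e β (c β i) ⊆ blockSystem m e c (Fin.castLE hM i) := by
  simp only [blockSystem, Fin.val_castLE, Fin.is_lt, dite_true]
  exact Finset.subset_biUnion_of_mem (fun β => wordGraph e β (c β i)) (Finset.mem_univ β)

lemma card_le_optCoverage_blockSystem {k : ℕ} (hk : 1 ≤ k) (hM : M ≤ m)
    (c : Fin L → Fin M ↪ (Fin d → K)) (β : Fin L) (i : Fin M) :
    Fintype.card K ≤ optCoverage k (blockSystem m e c) (wordGraph e β (c β i)) := by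
  have h1 : coverage (blockSystem m e c) {Fin.castLE hM i} (wordGraph e β (c β i))
      ≤ optCoverage k (blockSystem m e c) (wordGraph e β (c β i)) :=
    Finset.le_sup (f := fun J => coverage (blockSystem m e c) J (wordGraph e β (c β i)))
      (by simpa using hk)
  refine le_trans ?_ h1
  rw [coverage, Finset.singleton_biUnion,
    Finset.inter_eq_right.mpr (wordGraph_subset_blockSystem e hM c β i), card_wordGraph]

variable [DecidableEq K]

/-- Two different polynomials of degree at most `l` agree in at most `l` points. -/
lemma card_wordEval_eq_le {l : ℕ} {v w : Fin (l + 1) → K} (h : v ≠ w) :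
    (Finset.univ.filter fun x : K => wordEval v x = wordEval w x).card ≤ l := by
  classical
  let P : Polynomial K := ∑ j : Fin (l + 1), Polynomial.monomial (j : ℕ) (v j - w j)
  have hcoeff (i : Fin (l + 1)) : P.coeff i = v i - w i := by
    simp only [P, Polynomial.finsetSum_coeff, Polynomial.coeff_monomial]
    rw [Finset.sum_eq_single i] <;> simp +contextual [Fin.val_inj]
  have hP : P ≠ 0 := by
    intro h0
    apply h
    funext i
    have := hcoeff i
    rw [h0, Polynomial.coeff_zero] at this
    exact (sub_eq_zero.mp this.symm)
  have hdeg : P.natDegree ≤ l :=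
    Polynomial.natDegree_sum_le_of_forall_le _ _ fun j _ =>
      (Polynomial.natDegree_monomial_le _).trans (by omega)
  refine (Polynomial.card_le_degree_of_subset_roots (p := P) ?_).trans hdeg
  intro x hx
  have hx' : wordEval v x = wordEval w x := by simpa using hx
  rw [Polynomial.mem_roots hP, Polynomial.IsRoot.def, Polynomial.eval_finsetSum]
  simp only [Polynomial.eval_monomial, sub_mul, Finset.sum_sub_distrib]
  exact sub_eq_zero.mpr hx'

lemma card_blockSystem_inter_le {l : ℕ} (hM : M ≤ m) (c : Fin L → Fin M ↪ (Fin (l + 1) → K))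
    (β : Fin L) (i : Fin M) (j : Fin m) (hj : j ≠ Fin.castLE hM i) :
    (blockSystem m e c j ∩ wordGraph e β (c β i)).card ≤ l := by
  by_cases h : (j : ℕ) < M
  · have hne : c β ⟨j, h⟩ ≠ c β i := by
      intro heq
      apply hj
      have := (c β).injective heq
      ext
      simp [← this]
    refine le_trans ?_ (card_wordEval_eq_le hne)
    refine (Finset.card_le_card ?_).trans (Finset.card_image_le
      (f := fun x => e (β, x, wordEval (c β i) x)))
    intro y hy
    simp only [blockSystem, h, dite_true, wordGraph, Finset.mem_inter, Finset.mem_biUnion,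
      Finset.mem_image, Finset.mem_univ, true_and] at hy
    obtain ⟨⟨β', x', hx'⟩, x, hx⟩ := hy
    have := e.injective (hx'.trans hx.symm)
    simp only [Prod.mk.injEq] at this
    obtain ⟨rfl, rfl, h3⟩ := this
    simp only [Finset.mem_image, Finset.mem_filter, Finset.mem_univ, true_and]
    exact ⟨x', h3, hx⟩
  · simp [blockSystem, h]

lemma coverage_blockSystem_le {l k : ℕ} (hM : M ≤ m) (c : Fin L → Fin M ↪ (Fin (l + 1) → K))
    (β : Fin L) (i : Fin M) (J : Finset (Fin m)) (hJ : J.card ≤ k) (hi : Fin.castLE hM i ∉ J) :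
    coverage (blockSystem m e c) J (wordGraph e β (c β i)) ≤ k * l := by
  rw [coverage, Finset.biUnion_inter]
  refine (Finset.card_biUnion_le_card_mul _ _ l fun j hj => ?_).trans
    (Nat.mul_le_mul_right _ hJ)
  exact card_blockSystem_inter_le e hM c β i j (by rintro rfl; exact hi hj)

end ReedSolomon

/-! ### Counting -/

/-- The inequality of the arithmetic and geometric means, cleared of roots and denominators. -/
lemma prod_mul_pow_card_le_sum_pow {M : ℕ} (a : Fin M → ℕ) :
    M ^ M * ∏ i, a i ≤ (∑ i, a i) ^ M := by
  rcases Nat.eq_zero_or_pos M with rfl | hM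
  · simp
  have hM' : (0 : ℝ) < M := by exact_mod_cast hM
  have h := Real.geom_mean_le_arith_mean Finset.univ (fun _ : Fin M => (1 : ℝ))
    (fun i => (a i : ℝ)) (by simp) (by simpa using hM') (by simp)
  simp only [Real.rpow_one, one_mul, Finset.sum_const, Finset.card_univ, Fintype.card_fin,
    nsmul_eq_mul, mul_one] at h
  have h2 := pow_le_pow_left₀ (by positivity) h M
  rw [Real.rpow_inv_natCast_pow (by positivity) hM.ne', div_pow, le_div_iff₀ (by positivity)] at h2
  have : (M : ℝ) ^ M * ∏ i, (a i : ℝ) ≤ (∑ i, (a i : ℝ)) ^ M := by linarith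
  exact_mod_cast this

lemma card_lt_of_forall_length_le {S : Finset (List Bool)} {B : ℕ}
    (h : ∀ s ∈ S, s.length ≤ B) : S.card < 2 ^ (B + 1) := by
  have hS : S ⊆ (Finset.range (B + 1)).biUnion fun j =>
      Finset.univ.image fun f : Fin j → Bool => List.ofFn f := by
    intro s hs
    simp only [Finset.mem_biUnion, Finset.mem_range, Finset.mem_image, Finset.mem_univ, true_and]
    exact ⟨s.length, Nat.lt_succ_of_le (h s hs), s.get, List.ofFn_get s⟩
  calc S.card ≤ ∑ j ∈ Finset.range (B + 1),
        (Finset.univ.image fun f : Fin j → Bool => List.ofFn f).card :=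
        (Finset.card_le_card hS).trans Finset.card_biUnion_le
    _ ≤ ∑ j ∈ Finset.range (B + 1), 2 ^ j :=
        Finset.sum_le_sum fun j _ => Finset.card_image_le.trans (by simp)
    _ < 2 ^ (B + 1) := Nat.geomSum_lt (le_refl 2) (by simp)

/-- At least a `2 ^ (-M)` fraction of the maps `Fin M → W` are injective. -/
lemma pow_le_two_pow_mul_card_embedding {W : Type*} [Fintype W] [DecidableEq W] {M : ℕ}
    (h : 2 * M ≤ Fintype.card W) :
    Fintype.card W ^ M ≤ 2 ^ M * Fintype.card (Fin M ↪ W) := by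
  rw [Fintype.card_embedding_eq, Fintype.card_fin]
  refine le_trans ?_ (Nat.mul_le_mul_left _ (Nat.pow_sub_le_descFactorial _ _))
  rw [← mul_pow]
  exact Nat.pow_le_pow_left (by omega) _

/-- Families of injections `c β : Fin M ↪ W` that are consistent with given lists: if every
`w : W` carries, for each `β`, a set of at most `k` labels, then few families give each `c β i`
the label `i`. -/
lemma card_consistent_mul_le {W : Type*} [Fintype W] [DecidableEq W] {M L k : ℕ}
    (T : Fin L → W → Finset (Fin M)) (hT : ∀ β w, (T β w).card ≤ k) :
    M ^ (M * L) * (Finset.univ.filter fun c : Fin L → Fin M ↪ W => ∀ β i, i ∈ T β (c β i)).card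
      ≤ (k * Fintype.card W) ^ (M * L) := by
  let a (β : Fin L) (i : Fin M) : Finset W := Finset.univ.filter fun w => i ∈ T β w
  have hsum (β : Fin L) : ∑ i, (a β i).card ≤ k * Fintype.card W := by
    have := Finset.sum_card_bipartiteAbove_eq_sum_card_bipartiteBelow
      (s := (Finset.univ : Finset (Fin M))) (t := (Finset.univ : Finset W)) (fun i w => i ∈ T β w)
    simp only [Finset.bipartiteAbove, Finset.bipartiteBelow, Finset.filter_univ_mem] at this
    calc ∑ i, (a β i).card = ∑ w, (T β w).card := this
      _ ≤ ∑ _w : W, k := Finset.sum_le_sum fun w _ => hT β w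
      _ = k * Fintype.card W := by simp [mul_comm]
  have hcard : (Finset.univ.filter fun c : Fin L → Fin M ↪ W => ∀ β i, i ∈ T β (c β i)).card
      ≤ ∏ β, ∏ i, (a β i).card := by
    calc _ ≤ (Fintype.piFinset fun β => Fintype.piFinset fun i => a β i).card := by
          refine Finset.card_le_card_of_injOn (fun c β i => c β i) ?_ ?_
          · intro c hc
            have hc' : ∀ β i, i ∈ T β (c β i) := by simpa using hc
            simpa [a] using hc'
          · intro c _ c' _ h
            funext β
            ext i
            exact congrFun (congrFun h β) i
      _ = _ := by simp [Fintype.card_piFinset]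
  calc _ ≤ M ^ (M * L) * ∏ β, ∏ i, (a β i).card := Nat.mul_le_mul_left _ hcard
    _ = ∏ β, (M ^ M * ∏ i, (a β i).card) := by
        rw [Finset.prod_mul_distrib]; simp [pow_mul]
    _ ≤ ∏ _β : Fin L, (k * Fintype.card W) ^ M :=
        Finset.prod_le_prod' fun β _ => (prod_mul_pow_card_le_sum_pow _).trans
          (Nat.pow_le_pow_left (hsum β) _)
    _ = _ := by simp [pow_mul]

/-- If the data structure is too short to determine the families of words, then on some query
the oracle misses the only set that meets the query in more than `l` elements. -/
lemma exists_bad_query {K : Type*} [Field K] [Fintype K] [DecidableEq K] {n m k M L l B : ℕ}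
    (e : Fin L × K × K ↪ Fin n) (hk : 1 ≤ k) (hM : M ≤ m)
    (hl : 2 * M ≤ Fintype.card K ^ (l + 1)) (A : CoverageOracle n m k)
    (hA : ∀ I, (A.store I).length ≤ B)
    (hB : (2 * k) ^ (M * L) * 2 ^ (B + 1) ≤ M ^ (M * L)) :
    ∃ I Q, Fintype.card K ≤ optCoverage k I Q ∧ A.value I Q ≤ k * l := by
  by_contra! hcon
  let W := Fin (l + 1) → K
  have hW : Fintype.card W = Fintype.card K ^ (l + 1) := by simp [W]
  let F := Fin L → Fin M ↪ W
  let code : F → List Bool := fun c => A.store (blockSystem m e c)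
  -- An answer without the index `i` would cover at most `k * l` elements of the query.
  have hmem (c : F) (β : Fin L) (i : Fin M) :
      Fin.castLE hM i ∈ A.answer (code c) (wordGraph e β (c β i)) := by
    by_contra hi
    have h1 := hcon (blockSystem m e c) (wordGraph e β (c β i))
      (card_le_optCoverage_blockSystem e hk hM c β i)
    exact absurd (coverage_blockSystem_le e hM c β i _ (A.card_answer_le _ _) hi) (not_le.mpr h1)
  -- The string `s` fixes all answers, so the families stored as `s` are consistent with one
  -- labelling.
  have hfib : ∀ s ∈ (Finset.univ : Finset F).image code,
      M ^ (M * L) * (Finset.univ.filter fun c : F => code c = s).card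
        ≤ (k * Fintype.card W) ^ (M * L) := by
    intro s hs
    obtain ⟨c₀, -, rfl⟩ := Finset.mem_image.mp hs
    let T (β : Fin L) (w : W) : Finset (Fin M) := Finset.univ.filter fun i =>
      Fin.castLE hM i ∈ A.answer (code c₀) (wordGraph e β w)
    refine le_trans (Nat.mul_le_mul_left _ (Finset.card_le_card ?_))
      (card_consistent_mul_le T fun β w => ?_)
    · intro c hc
      have hc' : code c = code c₀ := by simpa using hc
      simp only [T, Finset.mem_filter, Finset.mem_univ, true_and]
      intro β i
      rw [← hc']
      exact hmem c β i
    · refine (Finset.card_le_card_of_injOn (Fin.castLE hM) ?_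
        (Fin.castLE_injective hM).injOn).trans
        (A.card_answer_le (blockSystem m e c₀) (wordGraph e β w))
      intro i hi
      simpa [T, code] using hi
  have hS : ((Finset.univ : Finset F).image code).card < 2 ^ (B + 1) := by
    refine card_lt_of_forall_length_le fun s hs => ?_
    obtain ⟨c, -, rfl⟩ := Finset.mem_image.mp hs
    exact hA _
  have hF : Fintype.card W ^ (M * L) ≤ 2 ^ (M * L) * Fintype.card F := by
    have := Nat.pow_le_pow_left
      (pow_le_two_pow_mul_card_embedding (W := W) (M := M) (hl.trans_eq hW.symm)) L
    simpa [F, mul_pow, pow_mul] using this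
  have hub : M ^ (M * L) * Fintype.card F
      ≤ (k * Fintype.card W) ^ (M * L) * ((Finset.univ : Finset F).image code).card := by
    rw [← Finset.card_univ, Finset.card_eq_sum_card_image code, Finset.mul_sum]
    exact (Finset.sum_le_sum hfib).trans (by simp [mul_comm])
  have hWpos : 0 < Fintype.card W := Fintype.card_pos
  have hchain : M ^ (M * L) * Fintype.card W ^ (M * L)
      < ((2 * k) ^ (M * L) * 2 ^ (B + 1)) * Fintype.card W ^ (M * L) := by
    calc M ^ (M * L) * Fintype.card W ^ (M * L)
        ≤ M ^ (M * L) * (2 ^ (M * L) * Fintype.card F) := Nat.mul_le_mul_left _ hF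
      _ = 2 ^ (M * L) * (M ^ (M * L) * Fintype.card F) := by ring
      _ ≤ 2 ^ (M * L) * ((k * Fintype.card W) ^ (M * L) *
            ((Finset.univ : Finset F).image code).card) := Nat.mul_le_mul_left _ hub
      _ = (2 * k * Fintype.card W) ^ (M * L) * ((Finset.univ : Finset F).image code).card := by
          rw [mul_assoc 2 k, mul_pow 2]; ring
      _ < (2 * k * Fintype.card W) ^ (M * L) * 2 ^ (B + 1) :=
          Nat.mul_lt_mul_of_pos_left hS (by positivity)
      _ = _ := by rw [mul_pow]; ring
  exact absurd hchain (not_lt.mpr (Nat.mul_le_mul_right _ hB))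

/-! ### From bad queries to the approximation ratio -/

namespace CoverageOracle

variable {n m k : ℕ} (A : CoverageOracle n m k)

lemma ofReal_lt_approxRatio {I : Fin m → Finset (Fin n)} {Q : Finset (Fin n)} {T : ℝ}
    (hT : 0 ≤ T) (h : T * A.value I Q < optCoverage k I Q) :
    ENNReal.ofReal T < A.approxRatio := by
  have h1 : ENNReal.ofReal T < (optCoverage k I Q : ℝ≥0∞) / (A.value I Q : ℝ≥0∞) := by
    rw [ENNReal.lt_div_iff_mul_lt (Or.inr ENNReal.ofReal_ne_top)
      (Or.inl (ENNReal.natCast_ne_top _)), ← ENNReal.ofReal_natCast, ← ENNReal.ofReal_mul hT,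
      ← ENNReal.ofReal_natCast]
    exact (ENNReal.ofReal_lt_ofReal_iff (lt_of_le_of_lt (by positivity) h)).mpr h
  exact h1.trans_le (le_iSup₂ (f := fun I Q =>
    (optCoverage k I Q : ℝ≥0∞) / (A.value I Q : ℝ≥0∞)) I Q)

lemma one_le_approxRatio (hn : 1 ≤ n) (hm : 1 ≤ m) (hk : 1 ≤ k) : 1 ≤ A.approxRatio := by
  let I : Fin m → Finset (Fin n) := fun _ => Finset.univ
  have hval : A.value I Finset.univ ≤ optCoverage k I Finset.univ :=
    Finset.le_sup (f := fun J => coverage I J Finset.univ)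
      (by simpa using A.card_answer_le I Finset.univ)
  have hopt : 1 ≤ optCoverage k I Finset.univ := by
    have : coverage I {⟨0, hm⟩} Finset.univ ≤ optCoverage k I Finset.univ :=
      Finset.le_sup (f := fun J => coverage I J Finset.univ) (by simpa using hk)
    refine le_trans ?_ this
    simpa [coverage, I] using hn
  have h1 : 1 ≤ (optCoverage k I Finset.univ : ℝ≥0∞) / (A.value I Finset.univ : ℝ≥0∞) := by
    rw [ENNReal.le_div_iff_mul_le (Or.inr (by exact_mod_cast (by omega)))
      (Or.inl (ENNReal.natCast_ne_top _)), one_mul]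
    exact_mod_cast hval
  exact h1.trans (le_iSup₂ (f := fun I Q =>
    (optCoverage k I Q : ℝ≥0∞) / (A.value I Q : ℝ≥0∞)) I Finset.univ)

/-- The lower bound in terms of the side length `r` of the blocks and the number `M` of nonempty
sets: `b * r ^ 2 ≤ 2 * n * M` says that `b` is at most twice the number of pairs of a set and a
block, and `log (2 * M) / log (r / 2)` bounds the degree of the polynomials. -/
lemma ofReal_lt_approxRatio_of_parameters {M : ℕ} {b r T : ℝ} (hk : 1 ≤ k) (hM : M ≤ m)
    (hb : 1 ≤ b) (hA : A.UsesAtMost b) (hr : 2 < r) (hrn : r ^ 2 ≤ n)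
    (hbr : b * r ^ 2 ≤ 2 * n * M) (hkM : 512 * k ≤ M) (hT : 0 ≤ T)
    (hTr : k * T * (Real.log (2 * M) / Real.log (r / 2)) ≤ r / 2) :
    ENNReal.ofReal T < A.approxRatio := by
  -- Bertrand's postulate: a prime `p` with `r / 2 < p ≤ r`.
  obtain ⟨p, hp, hlt, hle⟩ := Nat.exists_prime_lt_and_le_two_mul ⌊r / 2⌋₊
    (Nat.pos_iff_ne_zero.mp (Nat.floor_pos.mpr (by linarith)))
  have : Fact p.Prime := ⟨hp⟩
  have hp1 : r / 2 < p := (Nat.floor_lt (by linarith)).mp hlt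
  have hp2 : (p : ℝ) ≤ r := by
    have h1 : (p : ℝ) ≤ 2 * (⌊r / 2⌋₊ : ℝ) := by exact_mod_cast hle
    have h2 := Nat.floor_le (show 0 ≤ r / 2 by linarith)
    linarith
  have hp0 : (0 : ℝ) < p := by exact_mod_cast hp.pos
  have hpp : (p : ℝ) ^ 2 ≤ r ^ 2 := pow_le_pow_left₀ hp0.le hp2 2
  have hpn : p ^ 2 ≤ n := by exact_mod_cast hpp.trans hrn
  -- The ground set has room for `L` blocks of size `p ^ 2` and, as `p ^ 2 ≤ n`, is more than
  -- half filled by them.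
  set L := n / p ^ 2 with hL
  have hL1 : 1 ≤ L := (Nat.one_le_div_iff (pow_pos hp.pos 2)).mpr hpn
  have hnL : n ≤ 2 * L * p ^ 2 := by
    have h1 := Nat.lt_div_mul_add (a := n) (pow_pos hp.pos 2)
    rw [← hL] at h1
    nlinarith
  have hLn : L * p ^ 2 ≤ n := Nat.div_mul_le_self _ _
  have hbL : b ≤ 4 * (M * L : ℕ) := by
    have h1 : (n : ℝ) ≤ 2 * L * r ^ 2 :=
      le_trans (by exact_mod_cast hnL) (mul_le_mul_of_nonneg_left hpp (by positivity))
    have h2 : b * r ^ 2 ≤ (4 * (M * L : ℕ)) * r ^ 2 := by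
      push_cast
      calc b * r ^ 2 ≤ 2 * n * M := hbr
        _ ≤ 2 * (2 * L * r ^ 2) * M := by gcongr
        _ = _ := by ring
    exact le_of_mul_le_mul_right h2 (by positivity)
  obtain ⟨e⟩ : Nonempty (Fin L × ZMod p × ZMod p ↪ Fin n) :=
    Function.Embedding.nonempty_of_card_le (by simpa [ZMod.card, sq] using hLn)
  have hB : ⌊b⌋₊ + 1 ≤ 8 * (M * L) := by
    have h1 : ((⌊b⌋₊ : ℕ) : ℝ) ≤ b := Nat.floor_le (by linarith)
    have : ((⌊b⌋₊ + 1 : ℕ) : ℝ) ≤ ((8 * (M * L) : ℕ) : ℝ) := by push_cast at hbL ⊢; linarith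
    exact_mod_cast this
  obtain ⟨I, Q, hopt, hval⟩ := exists_bad_query (l := Nat.log p (2 * M)) (B := ⌊b⌋₊) e hk hM
    (by rw [ZMod.card]; exact (Nat.lt_pow_succ_log_self hp.one_lt _).le) A
    (fun I => Nat.le_floor (hA I))
    (calc (2 * k) ^ (M * L) * 2 ^ (⌊b⌋₊ + 1)
        ≤ (2 * k) ^ (M * L) * 2 ^ (8 * (M * L)) :=
          Nat.mul_le_mul_left _ (Nat.pow_le_pow_right (by norm_num) hB)
      _ = (512 * k) ^ (M * L) := by
          rw [pow_mul 2 8, ← mul_pow]; congr 1; ring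
      _ ≤ M ^ (M * L) := Nat.pow_le_pow_left hkM _)
  rw [ZMod.card] at hopt
  refine A.ofReal_lt_approxRatio hT (I := I) (Q := Q) ?_
  have hM1 : 1 ≤ M := by omega
  have hlogM : 0 ≤ Real.log (2 * M) :=
    Real.log_nonneg (by have : (1 : ℝ) ≤ M := by exact_mod_cast hM1
                        linarith)
  have hlog : (Nat.log p (2 * M) : ℝ) ≤ Real.log (2 * M) / Real.log (r / 2) := by
    have h1 : (Nat.log p (2 * M) : ℝ) ≤ Real.logb p ((2 * M : ℕ) : ℝ) :=
      Real.natLog_le_logb _ _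
    have h2 : 0 < Real.log (r / 2) := Real.log_pos (by linarith)
    have h3 : Real.log (r / 2) ≤ Real.log p := Real.log_le_log (by linarith) hp1.le
    rw [Real.logb] at h1
    push_cast at h1
    exact h1.trans (div_le_div_of_nonneg_left hlogM h2 h3)
  calc T * A.value I Q ≤ T * (k * Nat.log p (2 * M)) := by
        gcongr
        exact_mod_cast hval
    _ = k * T * Nat.log p (2 * M) := by ring
    _ ≤ k * T * (Real.log (2 * M) / Real.log (r / 2)) := by gcongr
    _ ≤ r / 2 := hTr
    _ < p := hp1
    _ ≤ optCoverage k I Q := by exact_mod_cast hopt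

/-- A bound of the form `X / (k * √k)` has to be checked only for `k ≤ X`, because the
approximation ratio is never below `1`. -/
lemma ofReal_div_lt_approxRatio {X : ℝ} (hn : 1 ≤ n) (hm : 1 ≤ m) (hk : 1 ≤ k) (hX : 0 ≤ X)
    (h : k ≤ X → ∀ T : ℝ, 0 ≤ T → k * T ≤ X → ENNReal.ofReal T < A.approxRatio) :
    ENNReal.ofReal (X / (k * Real.sqrt k)) < A.approxRatio := by
  have hk' : (1 : ℝ) ≤ k := by exact_mod_cast hk
  have hs : 1 ≤ Real.sqrt k := Real.one_le_sqrt.mpr hk'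
  by_cases hX1 : X / (k * Real.sqrt k) < 1
  · exact (ENNReal.ofReal_lt_one.mpr hX1).trans_le (A.one_le_approxRatio hn hm hk)
  · rw [not_lt, one_le_div (by positivity)] at hX1
    refine h (by nlinarith) _ (by positivity) ?_
    rw [← mul_div_assoc, mul_div_mul_left _ _ (by positivity)]
    exact div_le_self hX hs

end CoverageOracle

/-! ### Asymptotics -/

/-- Where `m ^ ε ≤ √n`: blocks of side about `m ^ ε` and all `m` sets. The degree is at most
logarithmic in `m`. -/
lemma lt_approxRatio_of_rpow_le_sqrt {δ C : ℝ} (hC : 0 < C) (hδ : 0 < δ) {n m k : ℕ} (hn : 1 ≤ n)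
    (hm : 2 ≤ m) (hk : 1 ≤ k) (h1 : 2 * Real.exp 1 * C ≤ (m : ℝ) ^ δ)
    (h2 : 2 * C * Real.log (2 * m) ≤ (m : ℝ) ^ δ) (h3 : 512 * C * Real.sqrt m ≤ m)
    {b ε : ℝ} (hnb : (n : ℝ) ≤ b) (hb : b = (n : ℝ) * (m : ℝ) ^ (1 - 2 * ε))
    (A : CoverageOracle n m k) (hA : A.UsesAtMost b) (hε : (m : ℝ) ^ ε ≤ Real.sqrt n) :
    ENNReal.ofReal (C * ((m : ℝ) ^ (ε - δ) / (k * Real.sqrt k))) < A.approxRatio := by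
  have hn' : (1 : ℝ) ≤ n := by exact_mod_cast hn
  have hm1 : (1 : ℝ) < m := by exact_mod_cast hm
  have hm0 : (0 : ℝ) < m := by linarith
  have hε2 : ε ≤ 1 / 2 := by
    by_contra hlt
    have h4 : (m : ℝ) ^ (1 - 2 * ε) < 1 := Real.rpow_lt_one_of_one_lt_of_neg hm1 (by linarith)
    have : b < n := by rw [hb]; nlinarith
    linarith
  set r : ℝ := (m : ℝ) ^ ε with hr
  set D : ℝ := (m : ℝ) ^ δ with hD
  have hr0 : 0 < r := Real.rpow_pos_of_pos hm0 _
  have hD1 : 1 ≤ D := Real.one_le_rpow hm1.le hδ.le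
  have hX : (m : ℝ) ^ (ε - δ) = r / D := Real.rpow_sub hm0 _ _
  rw [← mul_div_assoc, hX]
  refine A.ofReal_div_lt_approxRatio hn (by omega) hk (by positivity) fun hkX T hT hkT => ?_
  have hk' : (1 : ℝ) ≤ k := by exact_mod_cast hk
  have hDr : D ≤ C * r := by
    have : 1 ≤ C * r / D := by rw [mul_div_assoc]; linarith
    rwa [one_le_div (by positivity)] at this
  have hre : Real.exp 1 ≤ r / 2 := by
    have : C * (2 * Real.exp 1) ≤ C * r := by linarith
    have := le_of_mul_le_mul_left this hC
    linarith
  have he : 2 < Real.exp 1 := by linarith [Real.exp_one_gt_d9]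
  have hlog : 1 ≤ Real.log (r / 2) := (Real.le_log_iff_exp_le (by linarith)).mpr hre
  have hlogm : 0 ≤ Real.log (2 * m) := Real.log_nonneg (by linarith)
  have hr2 : r ^ 2 ≤ n := by
    have := pow_le_pow_left₀ hr0.le hε 2
    rwa [Real.sq_sqrt (by positivity)] at this
  refine A.ofReal_lt_approxRatio_of_parameters (b := b) (r := r) hk le_rfl (hn'.trans hnb) hA
    (by linarith) hr2 ?_ ?_ hT ?_
  · have : b * r ^ 2 = n * m := by
      rw [hb, hr, ← Real.rpow_mul_natCast hm0.le, mul_assoc, ← Real.rpow_add hm0]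
      rw [show 1 - 2 * ε + ε * (2 : ℕ) = 1 by push_cast; ring, Real.rpow_one]
    rw [this]
    nlinarith [mul_pos (show (0 : ℝ) < n by linarith) hm0]
  · have hrs : r ≤ Real.sqrt m := by
      rw [Real.sqrt_eq_rpow]
      exact Real.rpow_le_rpow_of_exponent_le hm1.le hε2
    have : (512 * k : ℝ) ≤ m := by
      have h5 : C * (r / D) ≤ C * r :=
        mul_le_mul_of_nonneg_left (div_le_self hr0.le hD1) hC.le
      have h6 : C * r ≤ C * Real.sqrt m := mul_le_mul_of_nonneg_left hrs hC.le
      linarith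
    exact_mod_cast this
  · calc k * T * (Real.log (2 * m) / Real.log (r / 2))
        ≤ C * (r / D) * Real.log (2 * m) :=
          mul_le_mul hkT (div_le_self hlogm hlog) (by positivity) (by positivity)
      _ = (2 * C * Real.log (2 * m)) * (r / (2 * D)) := by field_simp
      _ ≤ D * (r / (2 * D)) := by gcongr
      _ = r / 2 := by field_simp

/-- Where `√n ≤ m ^ ε`: blocks of side about `√n` and only `⌊b⌋` of the
sets. The degree is at most of order `n ^ δ / log n`, and the factor `log n` beats the
constant `C`. -/
lemma lt_approxRatio_of_sqrt_le_rpow {δ C : ℝ} (hC : 0 < C) (hδ : 0 < δ) {n m k : ℕ} (hn : 1 ≤ n)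
    (hm : 1 ≤ m) (hk : 1 ≤ k) (h1 : 2 < Real.sqrt n) (h2 : 4 * C ≤ Real.log (Real.sqrt n / 2))
    (h3 : 512 * C * Real.sqrt n ≤ n)
    {b ε : ℝ} (hnb : (n : ℝ) ≤ b) (hb : b = (n : ℝ) * (m : ℝ) ^ (1 - 2 * ε))
    (A : CoverageOracle n m k) (hA : A.UsesAtMost b) (hε : Real.sqrt n ≤ (m : ℝ) ^ ε)
    (hbe : b ≤ Real.exp ((n : ℝ) ^ δ)) :
    ENNReal.ofReal (C * ((n : ℝ) ^ (1 / 2 - δ) / (k * Real.sqrt k))) < A.approxRatio := by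
  have hn' : (1 : ℝ) ≤ n := by exact_mod_cast hn
  have hn0 : (0 : ℝ) < n := by linarith
  have hm0 : (0 : ℝ) < m := by exact_mod_cast hm
  set r : ℝ := Real.sqrt n with hr
  set D : ℝ := (n : ℝ) ^ δ with hD
  have hr0 : 0 < r := by linarith
  have hr2 : r ^ 2 = n := Real.sq_sqrt hn0.le
  have hD1 : 1 ≤ D := Real.one_le_rpow hn' hδ.le
  have hX : (n : ℝ) ^ (1 / 2 - δ) = r / D := by rw [Real.rpow_sub hn0, hr, Real.sqrt_eq_rpow]
  rw [← mul_div_assoc, hX]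
  refine A.ofReal_div_lt_approxRatio hn hm hk (by positivity) fun hkX T hT hkT => ?_
  have hb0 : 0 ≤ b := by linarith
  have hbm : b ≤ m := by
    have h4 : (n : ℝ) ≤ (m : ℝ) ^ (2 * ε) := by
      have := pow_le_pow_left₀ hr0.le hε 2
      rwa [hr2, ← Real.rpow_mul_natCast hm0.le, mul_comm ε] at this
    -- `b = n * m / m ^ (2 * ε)`, and the denominator is at least `n`.
    rw [hb, Real.rpow_sub hm0, Real.rpow_one, ← mul_div_assoc,
      div_le_iff₀ (Real.rpow_pos_of_pos hm0 _), mul_comm]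
    exact mul_le_mul_of_nonneg_left h4 hm0.le
  have hMb : (⌊b⌋₊ : ℝ) ≤ b := Nat.floor_le hb0
  have hnM : (n : ℝ) ≤ ⌊b⌋₊ := by exact_mod_cast Nat.le_floor hnb
  have hlogr : 0 < Real.log (r / 2) := Real.log_pos (by linarith)
  refine A.ofReal_lt_approxRatio_of_parameters (M := ⌊b⌋₊) (b := b) (r := r) hk ?_
    (hn'.trans hnb) hA h1 hr2.le ?_ ?_ hT ?_
  · exact_mod_cast hMb.trans hbm
  · -- No loss of more than a factor `2` in rounding `b` down, because `b ≥ 1`.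
    rw [hr2]
    have h5 : b ≤ 2 * (⌊b⌋₊ : ℝ) := by linarith [Nat.lt_floor_add_one b]
    nlinarith
  · have : (512 * k : ℝ) ≤ ⌊b⌋₊ := by
      have h5 : C * (r / D) ≤ C * r :=
        mul_le_mul_of_nonneg_left (div_le_self hr0.le hD1) hC.le
      linarith
    exact_mod_cast this
  · have hlogM : Real.log (2 * ⌊b⌋₊) ≤ 2 * D := by
      rw [Real.log_mul (by norm_num) (by linarith)]
      have h5 : Real.log ⌊b⌋₊ ≤ D :=
        (Real.log_le_iff_le_exp (by linarith)).mpr (hMb.trans hbe)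
      linarith [Real.log_two_lt_d9]
    have hlogM0 : 0 ≤ Real.log (2 * ⌊b⌋₊) := Real.log_nonneg (by linarith)
    calc k * T * (Real.log (2 * ⌊b⌋₊) / Real.log (r / 2))
        ≤ C * (r / D) * (2 * D / (4 * C)) :=
          mul_le_mul hkT (div_le_div₀ (by positivity) hlogM (by positivity) h2)
            (by positivity) (by positivity)
      _ = r / 2 := by field_simp; norm_num

open Filter in
/-- The largeness conditions on `n` and `m` that the two regimes need. -/
lemma eventually_size_conditions {δ C : ℝ} (hδ : 0 < δ) :
    ∀ᶠ x : ℕ in atTop, 2 ≤ x ∧ 2 * Real.exp 1 * C ≤ (x : ℝ) ^ δ ∧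
      2 * C * Real.log (2 * x) ≤ (x : ℝ) ^ δ ∧ 512 * C * Real.sqrt x ≤ x ∧
      2 < Real.sqrt x ∧ 4 * C ≤ Real.log (Real.sqrt x / 2) := by
  have hpow : Tendsto (fun x : ℝ => x ^ δ) atTop atTop := tendsto_rpow_atTop hδ
  have hsqrt := Real.tendsto_sqrt_atTop
  have hlog : Tendsto (fun x : ℝ => Real.log (Real.sqrt x / 2)) atTop atTop :=
    Real.tendsto_log_atTop.comp (hsqrt.atTop_div_const (by norm_num))
  have hlittle : ∀ᶠ x : ℝ in atTop, 2 * C * Real.log (2 * x) ≤ x ^ δ := by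
    have ho := (isLittleO_log_rpow_atTop hδ).bound
      (show 0 < 1 / (2 * (|2 * C| + 1)) by positivity)
    filter_upwards [ho, hpow.eventually_ge_atTop (2 * (|2 * C| * Real.log 2)),
      eventually_ge_atTop (1 : ℝ)] with x hx hx2 hx1
    have hx0 : 0 < x := by linarith
    rw [Real.norm_of_nonneg (Real.log_nonneg hx1), Real.norm_of_nonneg (by positivity),
      one_div, inv_mul_eq_div, le_div_iff₀ (by positivity)] at hx
    have hl := Real.log_nonneg hx1
    have hl2 : 0 ≤ Real.log 2 := Real.log_nonneg (by norm_num)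
    rw [Real.log_mul (by norm_num) hx0.ne']
    have : 2 * C * (Real.log 2 + Real.log x) ≤ |2 * C| * (Real.log 2 + Real.log x) :=
      mul_le_mul_of_nonneg_right (le_abs_self _) (by positivity)
    linarith
  have hroot : ∀ᶠ x : ℝ in atTop, 512 * C * Real.sqrt x ≤ x := by
    filter_upwards [hsqrt.eventually_ge_atTop (512 * C), eventually_ge_atTop (0 : ℝ)] with x hx hx0
    calc 512 * C * Real.sqrt x ≤ Real.sqrt x * Real.sqrt x := by gcongr
      _ = x := Real.mul_self_sqrt hx0
  have hcast := tendsto_natCast_atTop_atTop (R := ℝ)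
  filter_upwards [eventually_ge_atTop 2, hcast.eventually (hpow.eventually_ge_atTop _),
    hcast.eventually hlittle, hcast.eventually hroot,
    hcast.eventually (hsqrt.eventually_gt_atTop 2),
    hcast.eventually (hlog.eventually_ge_atTop (4 * C))] with x a1 a2 a3 a4 a5 a6
  exact ⟨a1, a2, a3, a4, a5, a6⟩

theorem theorem2 (δ : ℝ) (hδ : 0 < δ) (C : ℝ) (hC : 0 < C) :
    ∃ N : ℕ, ∀ n m k : ℕ, N ≤ n → N ≤ m → 1 ≤ k →
      ∀ b ε : ℝ, (n : ℝ) ≤ b → b ≤ (n : ℝ) * (m : ℝ) →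
        b = (n : ℝ) * (m : ℝ) ^ (1 - 2 * ε) →
        ∀ A : CoverageOracle n m k, A.UsesAtMost b →
          ((m : ℝ) ^ ε ≤ Real.sqrt (n : ℝ) →
            ENNReal.ofReal (C * ((m : ℝ) ^ (ε - δ) / ((k : ℝ) * Real.sqrt (k : ℝ))))
              < A.approxRatio) ∧
          (Real.sqrt (n : ℝ) ≤ (m : ℝ) ^ ε → b ≤ Real.exp ((n : ℝ) ^ δ) →
            ENNReal.ofReal (C * ((n : ℝ) ^ (1 / 2 - δ) / ((k : ℝ) * Real.sqrt (k : ℝ))))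
              < A.approxRatio) := by
  obtain ⟨N, hN⟩ := Filter.eventually_atTop.mp (eventually_size_conditions (C := C) hδ)
  refine ⟨N, fun n m k hn hm hk b ε hnb _ hb A hA => ?_⟩
  obtain ⟨n1, -, -, n4, n5, n6⟩ := hN n hn
  obtain ⟨m1, m2, m3, m4, -, -⟩ := hN m hm
  exact ⟨fun hε => lt_approxRatio_of_rpow_le_sqrt hC hδ (by omega) m1 hk m2 m3 m4 hnb hb A hA hε,
    fun hε hbe => lt_approxRatio_of_sqrt_le_rpow hC hδ (by omega) (by omega) hk n5 n6 n4 hnb hb A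
      hA hε hbe⟩
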